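/- Let $X=\{0,1\}\sqcup S$ be a finite state set with two boundary states $0,1$ and a finite set $S$ of internal states. Let $\mathbf P$ be the transition matrix of a Markov chain on $X$ for which $0$ and $1$ are absorbing; write $P_{00}=(p_{kl})_{k,l\in S}$ and $P_{01}=(p_{ki})_{k\in S,\,i\in\{0,1\}}$. For $k\in S$ let $\hat b_{k0},\hat b_{k1}$ be the probabilities that this chain, started at $k$, is absorbed in $0$, respectively in $1$, and assume that $\hat b_{k0}>0$, $\hat b_{k1}>0$ and $\hat b_{k0}+\hat b_{k1}=1$ for all $k\in S$. Let $\alpha^{(0)},\alpha^{(1)}$ be probability distributions on $S$. The controlled process $(\xi_t)_{t=0,1,2,\dots}$, with any initial law on $X$, is the Markov chain that moves from internal states according to $\mathbf P$ and that, whenever it is in a boundary state $i\in\{0,1\}$, is transferred in one step to an internal state chosen according to $\alpha^{(i)}$. A stay in $k\in S$ brings a (possibly random) income with mean $\hat c_k$, given the trajectory up to that moment, and a transfer from $i$ to $k$ brings a (possibly random, in applications negative) profit with mean $\hat d^{(i)}_k$, given the trajectory up to and including the transfer; the mean absolute profit of a single step, given the trajectory up to its beginning, is bounded by a constant. Let $\hat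 r_k$ be the mean income of the absorbing chain started at $k$ until its absorption. Let $t'_0<t'_1<\cdots$ be the moments at which $\xi$ is in $\{0,1\}$, let $\xi'_n=\xi_{t'_n}$ be the auxiliary chain on $\{0,1\}$, and let $V(n)$ be the expectation of the profit accumulated at the times $t<t'_n$. Then almost surely all $t'_n$ are finite, all $V(n)$ exist, and the stationary mean specific profit $\hat I=\lim_{n\to\infty}V(n)/n$ (the mean profit per step of the auxiliary chain, that is, per control period) exists and equals $$\hat I=\frac{\sum_{k}\alpha^{(0)}_k\bigl[\hat d^{(0)}_k+\hat r_k\bigr]\sum_{l}\alpha^{(1)}_l\hat b_{l0}+\sum_{k}\alpha^{(1)}_k\bigl[\hat d^{(1)}_k+\hat r_k\bigr]\sum_{l}\alpha^{(0)}_l(1-\hat b_{l0})}{\sum_{l}\alpha^{(1)}_l\hat b_{l0}+\sum_{l}\alpha^{(0)}_l(1-\hat b_{l0})},$$ where all sums are over $S$ and the denominator is positive. Here $I-P_{00}$ is invertible, $(\hat b_{k0},\hat b_{k1})_{k\in S}=(I-P_{00})^{-1}P_{01}$ and $\hat r=(I-P_{00})^{-1}\hat c$. -/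

import Mathlib

open MeasureTheory Filter Topology

/-- Data of the discrete-time tuning model. The boundary (absorbing) states `0`, `1` are the
elements of `Fin 2`; the finite type `S` is the set of internal (admissible) states. -/
structure TuningModel (S : Type*) [Fintype S] where
  /-- transition probabilities between internal states -/
  P00 : Matrix S S ℝ
  /-- transition probabilities from internal states to boundary states -/
  P01 : Matrix S (Fin 2) ℝ
  P00_nonneg : ∀ k l, 0 ≤ P00 k l
  P01_nonneg : ∀ k i, 0 ≤ P01 k i
  row_sum : ∀ k, ∑ i, P01 k i + ∑ l, P00 k l = 1
  /-- `α i` is the controlling distribution: it is the law of the internal state to which the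
  process is transferred from the boundary state `i` -/
  α : Fin 2 → S → ℝ
  α_nonneg : ∀ i k, 0 ≤ α i k
  α_sum : ∀ i, ∑ k, α i k = 1
  /-- `c k` is the mean income of a single stay in the internal state `k` -/
  c : S → ℝ
  /-- `d i k` is the mean profit (in applications negative: a cost) of the control action that
  transfers the process from the boundary state `i` to the internal state `k` -/
  d : Fin 2 → S → ℝ

namespace TuningModel

variable {S : Type*} [Fintype S] [DecidableEq S]

/-- Transition matrix of the absorbing chain (between control actions), both boundary states
being absorbing. -/
def P (M : TuningModel S) : Matrix (Fin 2 ⊕ S) (Fin 2 ⊕ S) ℝ :=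
  Matrix.fromBlocks 1 0 M.P01 M.P00

/-- Transition matrix of the controlled process: from an internal state it moves as the absorbing
chain does, and from a boundary state `i` it is transferred, in one step, to an internal state
chosen according to `α i`. -/
def Q (M : TuningModel S) : Matrix (Fin 2 ⊕ S) (Fin 2 ⊕ S) ℝ :=
  Matrix.fromBlocks 0 (Matrix.of M.α) M.P01 M.P00

/-- Probability that the absorbing chain started at `k` is absorbed in `i`: the events
"the chain is in `i` at time `t`" increase with `t` to the event of absorption in `i`. -/
noncomputable def absorbProb (M : TuningModel S) (k : S) (i : Fin 2) : ℝ :=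
  ⨆ t : ℕ, (M.P ^ t) (Sum.inr k) (Sum.inl i)

/-- Mean income collected by the absorbing chain started at `k` until its absorption: the sum over
the times `t` of the mean income of the stay at time `t`. -/
noncomputable def meanIncome (M : TuningModel S) (k : S) : ℝ :=
  ∑' t : ℕ, ∑ l, (M.P ^ t) (Sum.inr k) (Sum.inr l) * M.c l

/-- Stability: from every internal state both boundary states are reached with positive
probability, and absorption is almost sure. -/
def Stable (M : TuningModel S) : Prop :=
  ∀ k, 0 < M.absorbProb k 0 ∧ 0 < M.absorbProb k 1 ∧ M.absorbProb k 0 + M.absorbProb k 1 = 1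

/-- The event that the trajectory of `ξ` agrees with `x` up to time `t`. -/
def cyl {Ω : Type*} (ξ : ℕ → Ω → Fin 2 ⊕ S) (x : ℕ → Fin 2 ⊕ S) (t : ℕ) : Set Ω :=
  {ω | ∀ s ≤ t, ξ s ω = x s}

/-- `ξ` is a controlled process of the model `M` with an arbitrary initial law, and `Y t` is the
(possibly random) profit of its step `t`: the income of the stay in `ξ t` if this state is internal,
and the profit of the control action leading from `ξ t` to `ξ (t + 1)` if `ξ t` is a boundary
state. -/
structure IsRealization (M : TuningModel S) {Ω : Type*} [MeasurableSpace Ω] (μ : Measure Ω)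
    (ξ : ℕ → Ω → Fin 2 ⊕ S) (Y : ℕ → Ω → ℝ) : Prop where
  measurableSet_state : ∀ t a, MeasurableSet {ω | ξ t ω = a}
  /-- Markov property with transition matrix `Q` -/
  markov : ∀ t x, μ.real (cyl ξ x (t + 1)) = μ.real (cyl ξ x t) * M.Q (x t) (x (t + 1))
  integrable : ∀ t, Integrable (Y t) μ
  /-- the mean absolute profit of a step, given the trajectory so far, is bounded -/
  bounded_mean : ∃ C : ℝ, ∀ t x, ∫ ω in cyl ξ x t, |Y t ω| ∂μ ≤ C * μ.real (cyl ξ x t)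
  /-- given the trajectory up to a stay in the internal state `k`, its mean income is `c k` -/
  income : ∀ t x k, x t = Sum.inr k →
    ∫ ω in cyl ξ x t, Y t ω ∂μ = M.c k * μ.real (cyl ξ x t)
  /-- given the trajectory up to a transfer from `i` to `k`, the mean profit of the transfer is
  `d i k` -/
  control : ∀ t x i k, x t = Sum.inl i → x (t + 1) = Sum.inr k →
    ∫ ω in cyl ξ x (t + 1), Y t ω ∂μ = M.d i k * μ.real (cyl ξ x (t + 1))

/-- The moment of the `n`-th hit (`n = 0, 1, 2, …`) of the boundary. If there are at most `n` hits
the value is `0`. -/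
noncomputable def hitTime {Ω : Type*} (ξ : ℕ → Ω → Fin 2 ⊕ S) (n : ℕ) (ω : Ω) : ℕ :=
  Nat.nth (fun t => ∃ i, ξ t ω = Sum.inl i) n

/-- The profit accumulated before the `n`-th hit of the boundary, that is, during the first `n`
steps of the auxiliary chain formed by the states of the process at the hits of the boundary (and
before the first hit). -/
noncomputable def profit {Ω : Type*} (ξ : ℕ → Ω → Fin 2 ⊕ S) (Y : ℕ → Ω → ℝ) (n : ℕ) (ω : Ω) : ℝ :=
  ∑ t ∈ Finset.range (hitTime ξ n ω), Y t ω

end TuningModel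

namespace TuningModel

variable {S : Type*} [Fintype S]

/-! The limit comes from a Poisson equation. Let `g` be the mean profit of a step and `I` the
claimed value. A function `h` on the finite state space satisfies `g - I * 1_boundary = h - Q h`
(`exists_poisson`). Summed over the times before hit number `n`, the left side has mean `V(n) - n
I`, because exactly `n` hits precede that moment; the right side telescopes in the mean to a
difference of two values of `h`. Hence `V(n) = n I + O(1)`, and no ergodic theorem for the auxiliary
chain is needed.

Exchanging means with these random sums requires finite mean hitting times. A second potential drops
by at least 1 per step in the mean, up to a cost `K` per hit (`exists_time_potential`); the same
telescoping bounds the expected number of steps before hit `n` by `B + K n` (`summable_beforeHit`),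
which also yields infinitely many hits almost surely.

Both potentials are built from `(1 - P00)⁻¹`, which exists as the limit of the geometric series
because stability forces `P00 ^ t → 0`. -/

theorem Q_mulVec_inl (M : TuningModel S) (h : Fin 2 ⊕ S → ℝ) (i : Fin 2) :
    M.Q.mulVec h (Sum.inl i) = ∑ k, M.α i k * h (Sum.inr k) := by
  simp [Q, Matrix.mulVec, dotProduct]

theorem Q_mulVec_inr (M : TuningModel S) (h : Fin 2 ⊕ S → ℝ) (k : S) :
    M.Q.mulVec h (Sum.inr k)
      = ∑ i, M.P01 k i * h (Sum.inl i) + ∑ l, M.P00 k l * h (Sum.inr l) := by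
  simp [Q, Matrix.mulVec, dotProduct]

/-! ### The absorbing chain and its fundamental matrix -/

variable [DecidableEq S]

theorem P_pow_inr_inr (M : TuningModel S) (t : ℕ) (k l : S) :
    (M.P ^ t) (Sum.inr k) (Sum.inr l) = (M.P00 ^ t) k l := by
  induction t generalizing k l with
  | zero => simp [Matrix.one_apply]
  | succ t ih =>
    rw [pow_succ, pow_succ, Matrix.mul_apply, Matrix.mul_apply, Fintype.sum_sum_type]
    simp [P, ← ih]

/-- Decomposition by the moment of absorption: `s < t` internal steps, then one step into `i`, where
the chain stays. -/
theorem P_pow_inr_inl (M : TuningModel S) (t : ℕ) (k : S) (i : Fin 2) :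
    (M.P ^ t) (Sum.inr k) (Sum.inl i) = ((∑ s ∈ Finset.range t, M.P00 ^ s) * M.P01) k i := by
  induction t with
  | zero => simp
  | succ t ih =>
    rw [pow_succ, Matrix.mul_apply, Fintype.sum_sum_type, Finset.sum_range_succ, Matrix.add_mul,
      Matrix.add_apply, ← ih, Matrix.mul_apply]
    simp only [P_pow_inr_inr]
    congr 1
    simp [P, Matrix.one_apply]

theorem P00_pow_nonneg (M : TuningModel S) (t : ℕ) (k l : S) : 0 ≤ (M.P00 ^ t) k l := by
  induction t generalizing k l with
  | zero => rw [pow_zero, Matrix.one_apply]; split_ifs <;> norm_num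
  | succ t ih =>
    rw [pow_succ, Matrix.mul_apply]
    exact Finset.sum_nonneg fun j _ => mul_nonneg (ih k j) (M.P00_nonneg j l)

theorem P_pow_row_sum (M : TuningModel S) (t : ℕ) (k : S) :
    ∑ i, (M.P ^ t) (Sum.inr k) (Sum.inl i) + ∑ l, (M.P00 ^ t) k l = 1 := by
  have hP : M.P.mulVec 1 = 1 := by
    funext x
    rcases x with i | k
    · simp [P, Matrix.mulVec, dotProduct, Matrix.one_apply]
    · simpa [P, Matrix.mulVec, dotProduct] using M.row_sum k
  have hPt : (M.P ^ t).mulVec 1 = 1 := by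
    induction t with
    | zero => simp
    | succ t ih => rw [pow_succ, ← Matrix.mulVec_mulVec, hP, ih]
  have h := congrFun hPt (Sum.inr k)
  simpa [Matrix.mulVec, dotProduct, P_pow_inr_inr] using h

theorem P_pow_inr_inl_nonneg (M : TuningModel S) (t : ℕ) (k : S) (i : Fin 2) :
    0 ≤ (M.P ^ t) (Sum.inr k) (Sum.inl i) := by
  rw [P_pow_inr_inl, Matrix.mul_apply]
  refine Finset.sum_nonneg fun j _ => mul_nonneg ?_ (M.P01_nonneg j i)
  rw [Matrix.sum_apply]
  exact Finset.sum_nonneg fun s _ => M.P00_pow_nonneg s k j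

theorem tendsto_absorbProb (M : TuningModel S) (k : S) (i : Fin 2) :
    Tendsto (fun t : ℕ => (M.P ^ t) (Sum.inr k) (Sum.inl i)) atTop (𝓝 (M.absorbProb k i)) := by
  refine tendsto_atTop_ciSup (monotone_nat_of_le_succ fun t => ?_) ⟨1, ?_⟩
  · rw [P_pow_inr_inl, P_pow_inr_inl, Finset.sum_range_succ, Matrix.add_mul, Matrix.add_apply]
    refine le_add_of_nonneg_right ?_
    rw [Matrix.mul_apply]
    exact Finset.sum_nonneg fun j _ => mul_nonneg (M.P00_pow_nonneg t k j) (M.P01_nonneg j i)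
  · rintro _ ⟨t, rfl⟩
    have h1 := M.P_pow_row_sum t k
    have h2 : 0 ≤ ∑ l, (M.P00 ^ t) k l := Finset.sum_nonneg fun l _ => M.P00_pow_nonneg t k l
    have h3 := Finset.single_le_sum (f := fun i => (M.P ^ t) (Sum.inr k) (Sum.inl i))
      (fun j _ => M.P_pow_inr_inl_nonneg t k j) (Finset.mem_univ i)
    simp only at h3 ⊢
    linarith

/-- The internal part of a stable chain dies out. -/
theorem Stable.tendsto_P00_pow {M : TuningModel S} (hM : M.Stable) :
    Tendsto (fun t : ℕ => M.P00 ^ t) atTop (𝓝 0) := by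
  suffices h : ∀ k l, Tendsto (fun t : ℕ => (M.P00 ^ t) k l) atTop (𝓝 0) from
    tendsto_pi_nhds.2 fun k => tendsto_pi_nhds.2 fun l => h k l
  intro k l
  have h1 : Tendsto (fun t : ℕ => 1 - ∑ i, (M.P ^ t) (Sum.inr k) (Sum.inl i)) atTop (𝓝 0) := by
    have := (tendsto_finsetSum Finset.univ fun i _ => M.tendsto_absorbProb k i).const_sub 1
    rwa [Fin.sum_univ_two (M.absorbProb k), (hM k).2.2, sub_self] at this
  refine squeeze_zero (fun t => M.P00_pow_nonneg t k l) (fun t => ?_) h1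
  have h2 := M.P_pow_row_sum t k
  have h3 : (M.P00 ^ t) k l ≤ ∑ l, (M.P00 ^ t) k l :=
    Finset.single_le_sum (fun j _ => M.P00_pow_nonneg t k j) (Finset.mem_univ l)
  linarith

/-- A kernel vector is fixed by every power of `P00`, and these powers tend to 0. -/
theorem Stable.isUnit_one_sub {M : TuningModel S} (hM : M.Stable) : IsUnit (1 - M.P00) := by
  rw [← Matrix.mulVec_injective_iff_isUnit]
  refine (injective_iff_map_eq_zero (1 - M.P00).mulVecLin).2 fun v hv => ?_
  have hv' : M.P00.mulVec v = v := by
    rw [Matrix.mulVecLin_apply, Matrix.sub_mulVec, Matrix.one_mulVec] at hv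
    exact (sub_eq_zero.1 hv).symm
  have hvt : ∀ t : ℕ, (M.P00 ^ t).mulVec v = v := by
    intro t
    induction t with
    | zero => simp
    | succ t ih => rw [pow_succ, ← Matrix.mulVec_mulVec, hv', ih]
  have hc : Continuous fun A : Matrix S S ℝ => A.mulVec v := by fun_prop
  have h1 := (hc.tendsto 0).comp hM.tendsto_P00_pow
  simp only [Function.comp_def, hvt, Matrix.zero_mulVec] at h1
  exact tendsto_nhds_unique tendsto_const_nhds h1

theorem Stable.tendsto_geom_sum {M : TuningModel S} (hM : M.Stable) :
    Tendsto (fun t : ℕ => ∑ s ∈ Finset.range t, M.P00 ^ s) atTop (𝓝 (1 - M.P00)⁻¹) := by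
  have hdet := (Matrix.isUnit_iff_isUnit_det _).1 hM.isUnit_one_sub
  have h : ∀ t : ℕ, ∑ s ∈ Finset.range t, M.P00 ^ s = (1 - M.P00)⁻¹ * (1 - M.P00 ^ t) := by
    intro t
    rw [← mul_neg_geom_sum, ← mul_assoc, Matrix.nonsing_inv_mul _ hdet, one_mul]
  simp only [h]
  simpa using (tendsto_const_nhds (x := (1 - M.P00)⁻¹)).mul (hM.tendsto_P00_pow.const_sub 1)

theorem Stable.absorbProb_eq {M : TuningModel S} (hM : M.Stable) (k : S) (i : Fin 2) :
    M.absorbProb k i = ((1 - M.P00)⁻¹ * M.P01) k i := by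
  have hc : Continuous fun A : Matrix S S ℝ => (A * M.P01) k i := by
    simp only [Matrix.mul_apply]; fun_prop
  refine tendsto_nhds_unique (M.tendsto_absorbProb k i) ?_
  simp only [P_pow_inr_inl]
  exact (hc.tendsto _).comp hM.tendsto_geom_sum

theorem Stable.meanIncome_eq {M : TuningModel S} (hM : M.Stable) (k : S) :
    M.meanIncome k = ∑ l, (1 - M.P00)⁻¹ k l * M.c l := by
  have h : ∀ l, HasSum (fun t : ℕ => (M.P00 ^ t) k l) ((1 - M.P00)⁻¹ k l) := by
    intro l
    rw [hasSum_iff_tendsto_nat_of_nonneg fun t => M.P00_pow_nonneg t k l]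
    have := tendsto_pi_nhds.1 (tendsto_pi_nhds.1 hM.tendsto_geom_sum k) l
    simpa [Matrix.sum_apply] using this
  simp only [meanIncome, P_pow_inr_inr]
  exact (hasSum_sum fun l _ => (h l).mul_right (M.c l)).tsum_eq

/-- `(I - P₀₀)⁻¹ v` solves the equation `w = v + P₀₀ w`. -/
theorem Stable.inv_mulVec_eq {M : TuningModel S} (hM : M.Stable) (v : S → ℝ) :
    (1 - M.P00)⁻¹.mulVec v = v + M.P00.mulVec ((1 - M.P00)⁻¹.mulVec v) := by
  have hdet := (Matrix.isUnit_iff_isUnit_det _).1 hM.isUnit_one_sub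
  have h : (1 - M.P00).mulVec ((1 - M.P00)⁻¹.mulVec v) = v := by
    rw [Matrix.mulVec_mulVec, Matrix.mul_nonsing_inv _ hdet, Matrix.one_mulVec]
  rw [Matrix.sub_mulVec, Matrix.one_mulVec] at h
  exact sub_eq_iff_eq_add.1 h

/-! ### Positivity of the denominator and the two potentials -/

theorem Stable.sum_mul_absorbProb_pos {M : TuningModel S} (hM : M.Stable) (i j : Fin 2) :
    0 < ∑ l, M.α i l * M.absorbProb l j := by
  have hb : ∀ l, 0 < M.absorbProb l j := by
    intro l
    fin_cases j
    · exact (hM l).1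
    · exact (hM l).2.1
  have h0 : 0 ≤ ∑ l, M.α i l * M.absorbProb l j :=
    Finset.sum_nonneg fun l _ => mul_nonneg (M.α_nonneg i l) (hb l).le
  refine lt_of_le_of_ne h0 fun h => ?_
  have h1 := (Finset.sum_eq_zero_iff_of_nonneg fun l _ =>
    mul_nonneg (M.α_nonneg i l) (hb l).le).1 h.symm
  have h2 : ∑ k, M.α i k = 0 := Finset.sum_eq_zero fun l hl =>
    (mul_eq_zero.1 (h1 l hl)).resolve_right (hb l).ne'
  rw [M.α_sum i] at h2
  exact one_ne_zero h2

/-- The mean profit of a step from a given state. -/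
def stepMean (M : TuningModel S) : Fin 2 ⊕ S → ℝ :=
  Sum.elim (fun i => ∑ k, M.α i k * M.d i k) M.c

/-- The stationary mean profit per control period. -/
noncomputable def meanProfit (M : TuningModel S) : ℝ :=
  ((∑ k, M.α 0 k * (M.d 0 k + M.meanIncome k)) * (∑ l, M.α 1 l * M.absorbProb l 0)
      + (∑ k, M.α 1 k * (M.d 1 k + M.meanIncome k)) * (∑ l, M.α 0 l * (1 - M.absorbProb l 0)))
    / (∑ l, M.α 1 l * M.absorbProb l 0 + ∑ l, M.α 0 l * (1 - M.absorbProb l 0))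

/-- The Poisson equation of the controlled chain: up to the mean profit `meanProfit` per hit of the
boundary, the mean profit of a step is the expected decrease of a potential. -/
theorem Stable.exists_poisson {M : TuningModel S} (hM : M.Stable) :
    ∃ h : Fin 2 ⊕ S → ℝ, ∀ x,
      M.stepMean x - M.meanProfit * Sum.elim (fun _ => 1) (fun _ => 0) x
        = h x - M.Q.mulVec h x := by
  have hβ : ∀ l, 1 - M.absorbProb l 0 = M.absorbProb l 1 := fun l => by
    linarith [(hM l).2.2]
  have h0 := hM.sum_mul_absorbProb_pos 1 0
  have h1 := hM.sum_mul_absorbProb_pos 0 1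
  have hα : ∑ l, M.α 1 l * M.absorbProb l 0 = 1 - ∑ l, M.α 1 l * M.absorbProb l 1 := by
    rw [← M.α_sum 1, ← Finset.sum_sub_distrib]
    exact Finset.sum_congr rfl fun l _ => by rw [← hβ]; ring
  set A0 := ∑ k, M.α 0 k * (M.d 0 k + M.meanIncome k) with hA0
  set A1 := ∑ k, M.α 1 k * (M.d 1 k + M.meanIncome k) with hA1
  set p := ∑ l, M.α 1 l * M.absorbProb l 0 with hp
  set q := ∑ l, M.α 0 l * M.absorbProb l 1 with hq
  have hpq : p + q ≠ 0 := (add_pos h0 h1).ne'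
  have hI : M.meanProfit = (A0 * p + A1 * q) / (p + q) := by simp only [meanProfit, hβ, ← hq]; rfl
  -- With the potential normalized to 0 at state 0 and equal to `H` at state 1, the equations at the
  -- boundary read `I = A0 + q H` and `I = A1 - p H`; this `H` solves both.
  set H := (A1 - A0) / (p + q) with hH
  have key : ∀ i, ∑ k, M.α i k * (M.meanIncome k + M.absorbProb k 1 * H)
      = ∑ k, M.α i k * (M.d i k + M.meanIncome k) - ∑ k, M.α i k * M.d i k
        + (∑ k, M.α i k * M.absorbProb k 1) * H := by
    intro i
    rw [Finset.sum_mul, ← Finset.sum_sub_distrib, ← Finset.sum_add_distrib]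
    exact Finset.sum_congr rfl fun k _ => by ring
  -- Inside, the potential is the expected income until absorption plus the expected boundary value
  -- of the potential.
  refine ⟨Sum.elim ![0, H] (fun k => M.meanIncome k + M.absorbProb k 1 * H), ?_⟩
  rintro (i | k)
  · rw [Q_mulVec_inl]
    simp only [stepMean, Sum.elim_inl, Sum.elim_inr, key]
    fin_cases i
    · simp only [Fin.zero_eta, Matrix.cons_val_zero, ← hA0, ← hq]
      have : M.meanProfit = A0 + q * H := by rw [hI, hH]; field_simp; ring
      rw [this]; ring
    · simp only [Fin.mk_one, Matrix.cons_val_one, Matrix.cons_val_zero, ← hA1]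
      have e : ∑ l, M.α 1 l * M.absorbProb l 1 = 1 - p := by linarith
      have : M.meanProfit = A1 - p * H := by rw [hI, hH]; field_simp; ring
      rw [this, e]; ring
  · rw [Q_mulVec_inr]
    have hr := congrFun (hM.inv_mulVec_eq M.c) k
    have hb := congrFun (hM.inv_mulVec_eq fun k => M.P01 k 1) k
    have er : (1 - M.P00)⁻¹.mulVec M.c = M.meanIncome := by
      funext k; rw [hM.meanIncome_eq]; rfl
    have eb : (1 - M.P00)⁻¹.mulVec (fun k => M.P01 k 1) = fun k => M.absorbProb k 1 := by
      funext k; rw [hM.absorbProb_eq, Matrix.mul_apply]; rfl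
    rw [er] at hr
    rw [eb] at hb
    simp only [Pi.add_apply, Matrix.mulVec, dotProduct] at hr hb
    simp only [stepMean, Sum.elim_inl, Sum.elim_inr, Fin.sum_univ_two, Matrix.cons_val_zero,
      Matrix.cons_val_one, mul_add, Finset.sum_add_distrib, ← mul_assoc, ← Finset.sum_mul]
    nth_rw 1 [hr]
    nth_rw 1 [hb]
    ring

/-- A potential that decreases by `1` in the mean at every step from an internal state. -/
theorem Stable.exists_time_potential {M : TuningModel S} (hM : M.Stable) :
    ∃ (u : Fin 2 ⊕ S → ℝ) (K : ℝ), 0 ≤ K ∧ ∀ x,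
      1 ≤ (u x - M.Q.mulVec u x) + K * Sum.elim (fun _ => 1) (fun _ => 0) x := by
  set w := (1 - M.P00)⁻¹.mulVec 1 with hw
  -- `w` is the mean time to absorption. At `i` the potential is 0 and its mean next value is `∑ k,
  -- α i k * w k`, so `K` must be at least one plus this; the sum of absolute values serves both
  -- boundary states.
  refine ⟨Sum.elim 0 w, ∑ i, |1 + ∑ k, M.α i k * w k|,
    Finset.sum_nonneg fun _ _ => abs_nonneg _, ?_⟩
  rintro (i | k)
  · rw [Q_mulVec_inl]
    have h1 := Finset.single_le_sum (f := fun i => |1 + ∑ k, M.α i k * w k|)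
      (fun i _ => abs_nonneg _) (Finset.mem_univ i)
    have h2 := le_abs_self (1 + ∑ k, M.α i k * w k)
    simp only [Sum.elim_inl, Sum.elim_inr, Pi.zero_apply] at h1 ⊢
    linarith
  · rw [Q_mulVec_inr]
    have h := congrFun (hM.inv_mulVec_eq 1) k
    rw [← hw] at h
    simp only [Pi.add_apply, Pi.one_apply, Matrix.mulVec, dotProduct] at h
    simp only [Sum.elim_inl, Sum.elim_inr, Pi.zero_apply, mul_zero, Finset.sum_const_zero]
    linarith

/-! ### Cylinders and events known at a given time -/

section Cylinder

variable {S : Type*} {Ω : Type*}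

theorem cyl_congr {ξ : ℕ → Ω → Fin 2 ⊕ S} {x y : ℕ → Fin 2 ⊕ S} {t : ℕ}
    (h : ∀ s ≤ t, x s = y s) : cyl ξ x t = cyl ξ y t := by
  ext ω
  exact forall₂_congr fun s hs => by rw [h s hs]

/-- The sequence that runs through `p` and stays at its initial state afterwards. -/
def extendPath {t : ℕ} (p : Fin (t + 1) → Fin 2 ⊕ S) (s : ℕ) : Fin 2 ⊕ S :=
  if h : s < t + 1 then p ⟨s, h⟩ else p 0

theorem mem_cyl_extendPath {ξ : ℕ → Ω → Fin 2 ⊕ S} {t : ℕ} (p : Fin (t + 1) → Fin 2 ⊕ S) (ω : Ω) :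
    ω ∈ cyl ξ (extendPath p) t ↔ (fun s : Fin (t + 1) => ξ s ω) = p := by
  constructor
  · intro h
    funext s
    have := h s (Nat.lt_succ_iff.1 s.2)
    rwa [extendPath, dif_pos s.2] at this
  · rintro rfl s hs
    simp [extendPath, Nat.lt_succ_iff.2 hs]

/-- A set of sequences is known at time `t` if membership depends on the states up to `t` only. -/
def KnownAt (t : ℕ) (D : Set (ℕ → Fin 2 ⊕ S)) : Prop :=
  ∀ x y, (∀ s ≤ t, x s = y s) → x ∈ D → y ∈ D

/-- The event that the trajectory of `ξ` belongs to `D`. -/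
def trajEvent (ξ : ℕ → Ω → Fin 2 ⊕ S) (D : Set (ℕ → Fin 2 ⊕ S)) : Set Ω :=
  {ω | (fun s => ξ s ω) ∈ D}

-- As the state space is finite, an event known at time `t` is a finite union of disjoint cylinders,
-- so conditions on cylinders extend to it by additivity.
open Classical in
theorem trajEvent_eq_biUnion [Fintype S] (ξ : ℕ → Ω → Fin 2 ⊕ S) {t : ℕ}
    {D : Set (ℕ → Fin 2 ⊕ S)} (hD : KnownAt t D) :
    trajEvent ξ D = ⋃ p ∈ Finset.univ.filter fun p : Fin (t + 1) → Fin 2 ⊕ S => extendPath p ∈ D,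
      cyl ξ (extendPath p) t := by
  ext ω
  simp only [Set.mem_iUnion, Finset.mem_filter, Finset.mem_univ, true_and, exists_prop,
    mem_cyl_extendPath]
  have h : ∀ s ≤ t, ξ s ω = extendPath (fun s : Fin (t + 1) => ξ s ω) s := fun s hs => by
    simp [extendPath, Nat.lt_succ_iff.2 hs]
  constructor
  · exact fun hω => ⟨_, hD _ _ h hω, rfl⟩
  · rintro ⟨p, hp, rfl⟩
    exact hD _ _ (fun s hs => (h s hs).symm) hp

variable [MeasurableSpace Ω]

theorem measurableSet_cyl {ξ : ℕ → Ω → Fin 2 ⊕ S}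
    (hξ : ∀ t a, MeasurableSet {ω | ξ t ω = a}) (x : ℕ → Fin 2 ⊕ S) (t : ℕ) :
    MeasurableSet (cyl ξ x t) := by
  have : cyl ξ x t = ⋂ s, ⋂ (_ : s ≤ t), {ω | ξ s ω = x s} := by
    ext ω; simp [cyl]
  rw [this]
  exact MeasurableSet.iInter fun s => MeasurableSet.iInter fun _ => hξ s _

theorem measurableSet_trajEvent [Fintype S] {ξ : ℕ → Ω → Fin 2 ⊕ S}
    (hξ : ∀ t a, MeasurableSet {ω | ξ t ω = a}) {t : ℕ} {D : Set (ℕ → Fin 2 ⊕ S)}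
    (hD : KnownAt t D) : MeasurableSet (trajEvent ξ D) := by
  classical
  rw [trajEvent_eq_biUnion ξ hD]
  exact Finset.measurableSet_biUnion _ fun p _ => measurableSet_cyl hξ _ t

/-- Mean inequalities given the trajectory so far extend to all events known at that time. -/
theorem setIntegral_trajEvent_mono [Fintype S] {μ : Measure Ω} {ξ : ℕ → Ω → Fin 2 ⊕ S}
    (hξ : ∀ t a, MeasurableSet {ω | ξ t ω = a}) {t : ℕ} {Z W : Ω → ℝ}
    (hZ : Integrable Z μ) (hW : Integrable W μ)
    (h : ∀ x, ∫ ω in cyl ξ x t, Z ω ∂μ ≤ ∫ ω in cyl ξ x t, W ω ∂μ)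
    {D : Set (ℕ → Fin 2 ⊕ S)} (hD : KnownAt t D) :
    ∫ ω in trajEvent ξ D, Z ω ∂μ ≤ ∫ ω in trajEvent ξ D, W ω ∂μ := by
  classical
  rw [trajEvent_eq_biUnion ξ hD]
  have hdisj : ∀ s : Set (Fin (t + 1) → Fin 2 ⊕ S),
      s.Pairwise (Function.onFun Disjoint fun p => cyl ξ (extendPath p) t) := by
    intro s p _ q _ hpq
    refine Set.disjoint_left.2 fun ω h1 h2 => hpq ?_
    rw [mem_cyl_extendPath] at h1 h2
    exact h1.symm.trans h2
  rw [integral_biUnion_finset _ (fun p _ => measurableSet_cyl hξ _ t) (hdisj _)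
      (fun p _ => hZ.integrableOn),
    integral_biUnion_finset _ (fun p _ => measurableSet_cyl hξ _ t) (hdisj _)
      (fun p _ => hW.integrableOn)]
  exact Finset.sum_le_sum fun p _ => h _

theorem setIntegral_trajEvent_congr [Fintype S] {μ : Measure Ω} {ξ : ℕ → Ω → Fin 2 ⊕ S}
    (hξ : ∀ t a, MeasurableSet {ω | ξ t ω = a}) {t : ℕ} {Z W : Ω → ℝ}
    (hZ : Integrable Z μ) (hW : Integrable W μ)
    (h : ∀ x, ∫ ω in cyl ξ x t, Z ω ∂μ = ∫ ω in cyl ξ x t, W ω ∂μ)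
    {D : Set (ℕ → Fin 2 ⊕ S)} (hD : KnownAt t D) :
    ∫ ω in trajEvent ξ D, Z ω ∂μ = ∫ ω in trajEvent ξ D, W ω ∂μ :=
  le_antisymm (setIntegral_trajEvent_mono hξ hZ hW (fun x => (h x).le) hD)
    (setIntegral_trajEvent_mono hξ hW hZ (fun x => (h x).ge) hD)

theorem integrable_comp_state [Fintype S] {μ : Measure Ω} [IsFiniteMeasure μ]
    {ξ : ℕ → Ω → Fin 2 ⊕ S} (hξ : ∀ t a, MeasurableSet {ω | ξ t ω = a})
    (g : Fin 2 ⊕ S → ℝ) (t : ℕ) : Integrable (fun ω => g (ξ t ω)) μ := by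
  classical
  have : (fun ω => g (ξ t ω))
      = fun ω => ∑ a, ({ω | ξ t ω = a} : Set Ω).indicator (fun _ => g a) ω := by
    funext ω
    simp [Set.indicator_apply]
  rw [this]
  exact integrable_finsetSum _ fun a _ => (integrable_const _).indicator (hξ t a)

theorem setIntegral_cyl_succ [Fintype S] {μ : Measure Ω} {ξ : ℕ → Ω → Fin 2 ⊕ S}
    (hξ : ∀ t a, MeasurableSet {ω | ξ t ω = a}) {Z : Ω → ℝ} (hZ : Integrable Z μ)
    (x : ℕ → Fin 2 ⊕ S) (t : ℕ) :
    ∫ ω in cyl ξ x t, Z ω ∂μ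
      = ∑ a, ∫ ω in cyl ξ (Function.update x (t + 1) a) (t + 1), Z ω ∂μ := by
  have hmem : ∀ a ω, ω ∈ cyl ξ (Function.update x (t + 1) a) (t + 1)
      ↔ ω ∈ cyl ξ x t ∧ ξ (t + 1) ω = a := by
    intro a ω
    constructor
    · refine fun h => ⟨fun s hs => ?_, by simpa using h (t + 1) le_rfl⟩
      simpa [Function.update_of_ne (show s ≠ t + 1 by omega)] using h s (by omega)
    · rintro ⟨h1, h2⟩ s hs
      rcases hs.eq_or_lt with rfl | hs
      · simpa using h2
      · simpa [Function.update_of_ne hs.ne] using h1 s (by omega)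
  have hU : cyl ξ x t = ⋃ a, cyl ξ (Function.update x (t + 1) a) (t + 1) := by
    ext ω
    simp [hmem]
  rw [hU, integral_iUnion_fintype (fun a => measurableSet_cyl hξ _ _) _
    (fun a => hZ.integrableOn)]
  intro a b hab
  exact Set.disjoint_left.2 fun ω h1 h2 =>
    hab (((hmem a ω).1 h1).2.symm.trans ((hmem b ω).1 h2).2)

theorem setIntegral_cyl_const {μ : Measure Ω} {ξ : ℕ → Ω → Fin 2 ⊕ S}
    (hξ : ∀ t a, MeasurableSet {ω | ξ t ω = a}) (g : Fin 2 ⊕ S → ℝ)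
    (x : ℕ → Fin 2 ⊕ S) (t : ℕ) :
    ∫ ω in cyl ξ x t, g (ξ t ω) ∂μ = g (x t) * μ.real (cyl ξ x t) := by
  rw [setIntegral_congr_fun (g := fun _ => g (x t)) (measurableSet_cyl hξ x t)
    (fun ω hω => by simp only [hω t le_rfl]), setIntegral_const, smul_eq_mul, mul_comm]

end Cylinder

/-! ### One-step means of a realization -/

namespace IsRealization

variable {S : Type*} [Fintype S] {M : TuningModel S} {Ω : Type*} [MeasurableSpace Ω]
  {μ : Measure Ω} {ξ : ℕ → Ω → Fin 2 ⊕ S} {Y : ℕ → Ω → ℝ}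

theorem setIntegral_next [IsFiniteMeasure μ] (hξ : M.IsRealization μ ξ Y) (h : Fin 2 ⊕ S → ℝ)
    {t : ℕ} {D : Set (ℕ → Fin 2 ⊕ S)} (hD : KnownAt t D) :
    ∫ ω in trajEvent ξ D, h (ξ (t + 1) ω) ∂μ
      = ∫ ω in trajEvent ξ D, M.Q.mulVec h (ξ t ω) ∂μ := by
  have hm := hξ.measurableSet_state
  refine setIntegral_trajEvent_congr hm (integrable_comp_state hm h (t + 1))
    (integrable_comp_state hm _ t) (fun x => ?_) hD
  rw [setIntegral_cyl_succ hm (integrable_comp_state hm h (t + 1)), setIntegral_cyl_const hm,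
    Matrix.mulVec, dotProduct, Finset.sum_mul]
  refine Finset.sum_congr rfl fun a _ => ?_
  rw [setIntegral_cyl_const hm, hξ.markov, cyl_congr (y := x) fun s hs =>
    Function.update_of_ne (by omega) _ _]
  simp only [Function.update_self, Function.update_of_ne (show t ≠ t + 1 by omega)]
  ring

/-- At a boundary state the mean profit is prescribed only once the transfer is known, so the
cylinder is split by the next state; a next state on the boundary has probability 0. -/
theorem setIntegral_step [IsFiniteMeasure μ] (hξ : M.IsRealization μ ξ Y)
    {t : ℕ} {D : Set (ℕ → Fin 2 ⊕ S)} (hD : KnownAt t D) :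
    ∫ ω in trajEvent ξ D, Y t ω ∂μ = ∫ ω in trajEvent ξ D, M.stepMean (ξ t ω) ∂μ := by
  have hm := hξ.measurableSet_state
  refine setIntegral_trajEvent_congr hm (hξ.integrable t) (integrable_comp_state hm _ t)
    (fun x => ?_) hD
  rw [setIntegral_cyl_const hm]
  rcases hx : x t with i | k
  · have hcyl : ∀ a, μ.real (cyl ξ (Function.update x (t + 1) a) (t + 1))
        = μ.real (cyl ξ x t) * M.Q (Sum.inl i) a := by
      intro a
      rw [hξ.markov, cyl_congr (y := x) fun s hs => Function.update_of_ne (by omega) _ _]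
      simp only [Function.update_self, Function.update_of_ne (show t ≠ t + 1 by omega), hx]
    rw [setIntegral_cyl_succ hm (hξ.integrable t), Fintype.sum_sum_type,
      Finset.sum_eq_zero fun j _ => ?_, zero_add]
    · simp only [stepMean, Sum.elim_inl, Finset.sum_mul]
      refine Finset.sum_congr rfl fun k _ => ?_
      rw [hξ.control t _ i k (by rw [Function.update_of_ne (by omega), hx])
        (by rw [Function.update_self]), hcyl]
      simp only [Q, Matrix.fromBlocks_apply₁₂, Matrix.of_apply]
      ring
    · have h0 : μ (cyl ξ (Function.update x (t + 1) (Sum.inl j)) (t + 1)) = 0 := by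
        rw [← measureReal_eq_zero_iff, hcyl]
        simp [Q]
      exact setIntegral_measure_zero _ h0
  · exact hξ.income t x k hx

theorem exists_setIntegral_abs_le [IsFiniteMeasure μ] (hξ : M.IsRealization μ ξ Y) :
    ∃ C : ℝ, ∀ t D, KnownAt t D →
      ∫ ω in trajEvent ξ D, |Y t ω| ∂μ ≤ C * μ.real (trajEvent ξ D) := by
  obtain ⟨C, hC⟩ := hξ.bounded_mean
  refine ⟨C, fun t D hD => ?_⟩
  have := setIntegral_trajEvent_mono hξ.measurableSet_state (hξ.integrable t).abs
    (integrable_const C) (fun x => (hC t x).trans (by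
      rw [setIntegral_const, smul_eq_mul, mul_comm])) hD
  rwa [setIntegral_const, smul_eq_mul, mul_comm] at this

end IsRealization

/-! ### Stopped sums and counting of hits -/

section Stopping

/-- A telescoping sum stopped at the end of a decreasing sequence of events stays bounded. -/
theorem abs_sum_stopped_sub_le (a : ℕ → ℝ) (G : ℕ → Prop) [DecidablePred G]
    (hG : ∀ s t, s ≤ t → G t → G s) {B : ℝ} (hB : ∀ t, |a t| ≤ B) (T : ℕ) :
    |∑ t ∈ Finset.range T, if G t then a t - a (t + 1) else 0| ≤ 2 * B := by
  -- `m` is the index at which telescoping stops. The second clause carries the induction: if `G`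
  -- holds at `T - 1` or later, nothing has stopped yet.
  have key : ∃ m, (∑ t ∈ Finset.range T, if G t then a t - a (t + 1) else 0) = a 0 - a m ∧
      ∀ t, G t → T ≤ t + 1 → m = T := by
    induction T with
    | zero => exact ⟨0, by simp, fun _ _ _ => rfl⟩
    | succ T ih =>
      obtain ⟨m, hm, h⟩ := ih
      rw [Finset.sum_range_succ, hm]
      by_cases hT : G T
      · obtain rfl := h T hT (by omega)
        exact ⟨m + 1, by rw [if_pos hT]; ring, fun _ _ _ => rfl⟩
      · exact ⟨m, by rw [if_neg hT, add_zero], fun t ht hle =>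
          (hT (hG T t (by omega) ht)).elim⟩
  obtain ⟨m, hm, -⟩ := key
  rw [hm]
  have h0 := abs_le.1 (hB 0)
  have h1 := abs_le.1 (hB m)
  exact abs_le.2 ⟨by linarith, by linarith⟩

theorem sum_range_count_le (p : ℕ → Prop) [DecidablePred p] (n T : ℕ) :
    (∑ t ∈ Finset.range T, if Nat.count p (t + 1) ≤ n then (if p t then 1 else 0) else 0)
      = min n (Nat.count p T) := by
  induction T with
  | zero => simp
  | succ T ih =>
    rw [Finset.sum_range_succ, ih]
    have := Nat.count_succ p T
    split_ifs at this ⊢ <;> omega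

variable {S : Type*}

/-- The indicator of the boundary. -/
def boundaryInd : Fin 2 ⊕ S → ℝ := Sum.elim (fun _ => 1) (fun _ => 0)

theorem boundaryInd_eq [DecidableEq S] (x : Fin 2 ⊕ S) :
    boundaryInd x = if ∃ i, x = Sum.inl i then 1 else 0 := by
  rcases x with i | k <;> simp [boundaryInd]

/-- The sequences with at most `n` hits of the boundary up to time `t`, that is, those for which
the hit number `n` (counted from `0`) takes place after `t`. -/
def beforeHit [DecidableEq S] (n t : ℕ) : Set (ℕ → Fin 2 ⊕ S) :=
  {x | Nat.count (fun s => ∃ i, x s = Sum.inl i) (t + 1) ≤ n}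

theorem knownAt_beforeHit [DecidableEq S] (n t : ℕ) :
    KnownAt t (beforeHit n t : Set (ℕ → Fin 2 ⊕ S)) := by
  intro x y h hx
  have : Nat.count (fun s => ∃ i, x s = Sum.inl i) (t + 1)
      = Nat.count (fun s => ∃ i, y s = Sum.inl i) (t + 1) := by
    rw [Nat.count_eq_card_filter_range, Nat.count_eq_card_filter_range]
    congr 1
    refine Finset.filter_congr fun s hs => ?_
    rw [h s (Nat.lt_succ_iff.1 (Finset.mem_range.1 hs))]
  exact this.symm.trans_le hx

theorem beforeHit_antitone [DecidableEq S] (n : ℕ) {s t : ℕ} (h : s ≤ t) :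
    (beforeHit n t : Set (ℕ → Fin 2 ⊕ S)) ⊆ beforeHit n s :=
  fun _ hx => (Nat.count_monotone _ (Nat.succ_le_succ h)).trans hx

/-- Infinitely many hits are needed to exclude the default value 0 of `hitTime`. -/
theorem lt_hitTime_iff [DecidableEq S] {Ω : Type*} {ξ : ℕ → Ω → Fin 2 ⊕ S} {ω : Ω}
    (h : ∃ᶠ t in atTop, ∃ i, ξ t ω = Sum.inl i) (n t : ℕ) :
    t < hitTime ξ n ω ↔ ω ∈ trajEvent ξ (beforeHit n t) :=
  (Nat.count_le_iff_le_nth (Nat.frequently_atTop_iff_infinite.1 h)).symm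

theorem sum_range_hitTime_boundaryInd {Ω : Type*} {ξ : ℕ → Ω → Fin 2 ⊕ S} {ω : Ω}
    (h : ∃ᶠ t in atTop, ∃ i, ξ t ω = Sum.inl i) (n : ℕ) :
    ∑ t ∈ Finset.range (hitTime ξ n ω), boundaryInd (ξ t ω) = n := by
  classical
  have := Nat.count_nth_of_infinite (Nat.frequently_atTop_iff_infinite.1 h) n
  rw [Nat.count_eq_card_filter_range] at this
  simp only [boundaryInd_eq, Finset.sum_boole]
  exact_mod_cast this

end Stopping

/-- A series of functions whose integral norms are summable has an integrable sum. -/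
theorem integrable_of_hasSum {Ω : Type*} [MeasurableSpace Ω] {μ : Measure Ω} {F : ℕ → Ω → ℝ}
    {f : Ω → ℝ} (hF : ∀ t, Integrable (F t) μ) (hs : Summable fun t => ∫ ω, ‖F t ω‖ ∂μ)
    (hf : ∀ᵐ ω ∂μ, HasSum (fun t => F t ω) (f ω)) : Integrable f μ := by
  refine ⟨aestronglyMeasurable_of_tendsto_ae atTop
    (f := fun T ω => ∑ t ∈ Finset.range T, F t ω)
    (fun T => (integrable_finsetSum _ fun t _ => hF t).1) ?_, ?_⟩
  · filter_upwards [hf] with ω hω using hω.tendsto_sum_nat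
  · have h1 : ∫⁻ ω, ‖f ω‖ₑ ∂μ ≤ ∫⁻ ω, ∑' t, ‖F t ω‖ₑ ∂μ := by
      refine lintegral_mono_ae ?_
      filter_upwards [hf] with ω hω
      rw [← hω.tsum_eq]
      exact enorm_tsum_le_tsum_enorm
    refine h1.trans_lt ?_
    rw [lintegral_tsum fun t => (hF t).1.enorm]
    simp only [← ofReal_integral_norm_eq_lintegral_enorm (hF _)]
    rw [← ENNReal.ofReal_tsum_of_nonneg (fun t => integral_nonneg fun ω => norm_nonneg _) hs]
    exact ENNReal.ofReal_lt_top

/-! ### Expected stopped sums of the controlled process -/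

namespace IsRealization

variable {S : Type*} [Fintype S] [DecidableEq S] {M : TuningModel S} {Ω : Type*}
  [MeasurableSpace Ω] {μ : Measure Ω} {ξ : ℕ → Ω → Fin 2 ⊕ S} {Y : ℕ → Ω → ℝ}

theorem measurableSet_beforeHit (hξ : M.IsRealization μ ξ Y) (n t : ℕ) :
    MeasurableSet (trajEvent ξ (beforeHit n t)) :=
  measurableSet_trajEvent hξ.measurableSet_state (knownAt_beforeHit n t)

variable [IsProbabilityMeasure μ]

/-- The total expected decrease of a potential before a hit of the boundary is bounded. -/
theorem exists_abs_sum_potential_le (hξ : M.IsRealization μ ξ Y) (h : Fin 2 ⊕ S → ℝ) :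
    ∃ B : ℝ, ∀ n T : ℕ, |∑ t ∈ Finset.range T,
      ∫ ω in trajEvent ξ (beforeHit n t), (h (ξ t ω) - M.Q.mulVec h (ξ t ω)) ∂μ| ≤ B := by
  classical
  refine ⟨2 * ∑ x, |h x|, fun n T => ?_⟩
  have hm := hξ.measurableSet_state
  have hi := fun (g : Fin 2 ⊕ S → ℝ) t => (integrable_comp_state (μ := μ) hm g t)
  -- The event is known at time `t`, so `Q h` at time `t` may be replaced by `h` at time `t + 1`;
  -- the sum then telescopes along each trajectory.
  have e : ∀ t, ∫ ω in trajEvent ξ (beforeHit n t), (h (ξ t ω) - M.Q.mulVec h (ξ t ω)) ∂μ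
      = ∫ ω, (trajEvent ξ (beforeHit n t)).indicator
          (fun ω => h (ξ t ω) - h (ξ (t + 1) ω)) ω ∂μ := by
    intro t
    rw [integral_indicator (hξ.measurableSet_beforeHit n t),
      integral_sub (hi _ _).integrableOn (hi _ _).integrableOn,
      integral_sub (hi _ _).integrableOn (hi _ _).integrableOn,
      hξ.setIntegral_next h (knownAt_beforeHit n t)]
  simp only [e]
  have hd : ∀ t, Integrable (fun ω => h (ξ t ω) - h (ξ (t + 1) ω)) μ := fun t =>
    (hi h t).sub (hi h (t + 1))
  rw [← integral_finsetSum _ fun t _ => (hd t).indicator (hξ.measurableSet_beforeHit n t)]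
  have hbound := norm_integral_le_of_norm_le_const (μ := μ) (C := 2 * ∑ x, |h x|)
    (f := fun ω => ∑ t ∈ Finset.range T, (trajEvent ξ (beforeHit n t)).indicator
          (fun ω => h (ξ t ω) - h (ξ (t + 1) ω)) ω) (Eventually.of_forall fun ω => by
      simp only [Set.indicator_apply, Real.norm_eq_abs]
      exact abs_sum_stopped_sub_le (fun t => h (ξ t ω)) (fun t => ω ∈ trajEvent ξ (beforeHit n t))
        (fun s t hst ht => beforeHit_antitone n hst ht)
        (fun t => Finset.single_le_sum (f := fun x => |h x|) (fun x _ => abs_nonneg _)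
          (Finset.mem_univ (ξ t ω))) T)
  simpa using hbound

/-- At most `n` hits are counted on every trajectory. This does not presuppose infinitely many hits,
which are only deduced later from this bound. -/
theorem sum_setIntegral_boundaryInd_le (hξ : M.IsRealization μ ξ Y) (n T : ℕ) :
    ∑ t ∈ Finset.range T, ∫ ω in trajEvent ξ (beforeHit n t), boundaryInd (ξ t ω) ∂μ ≤ n := by
  classical
  have hi := fun t => (integrable_comp_state (μ := μ) hξ.measurableSet_state boundaryInd t)
  simp only [← integral_indicator (hξ.measurableSet_beforeHit n _)]
  rw [← integral_finsetSum _ fun t _ => (hi t).indicator (hξ.measurableSet_beforeHit n t)]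
  have : ∀ ω, ∑ t ∈ Finset.range T, (trajEvent ξ (beforeHit n t)).indicator
      (fun ω => boundaryInd (ξ t ω)) ω ≤ (n : ℝ) := by
    intro ω
    have h := sum_range_count_le (fun s => ∃ i, ξ s ω = Sum.inl i) n T
    have h' := h.trans_le (min_le_left _ _)
    simp only [Set.indicator_apply, boundaryInd_eq, trajEvent, beforeHit, Set.mem_ofPred_eq]
    have h2 := (Nat.cast_le (α := ℝ)).2 h'
    push_cast at h2
    convert h2
  calc _ ≤ ∫ _, (n : ℝ) ∂μ := integral_mono
        (integrable_finsetSum _ fun t _ => (hi t).indicator (hξ.measurableSet_beforeHit n t))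
        (integrable_const _) this
    _ = n := by simp

/-- The mean moment of every hit of the boundary is finite. -/
theorem summable_beforeHit (hM : M.Stable) (hξ : M.IsRealization μ ξ Y) (n : ℕ) :
    Summable fun t => μ.real (trajEvent ξ (beforeHit n t)) := by
  obtain ⟨u, K, hK, hu⟩ := hM.exists_time_potential
  obtain ⟨B, hB⟩ := hξ.exists_abs_sum_potential_le u
  have hi := fun (g : Fin 2 ⊕ S → ℝ) t =>
    (integrable_comp_state (μ := μ) hξ.measurableSet_state g t)
  refine summable_of_sum_range_le (c := B + K * n) (fun _ => measureReal_nonneg) fun T => ?_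
  have h1 : ∀ t, μ.real (trajEvent ξ (beforeHit n t))
      ≤ ∫ ω in trajEvent ξ (beforeHit n t), (u (ξ t ω) - M.Q.mulVec u (ξ t ω)) ∂μ
        + K * ∫ ω in trajEvent ξ (beforeHit n t), boundaryInd (ξ t ω) ∂μ := by
    intro t
    have hd : Integrable (fun ω => u (ξ t ω) - M.Q.mulVec u (ξ t ω)) μ :=
      (hi u t).sub (hi _ t)
    rw [← integral_const_mul, ← integral_add hd.integrableOn ((hi _ t).const_mul K).integrableOn]
    calc _ = ∫ _ in trajEvent ξ (beforeHit n t), (1 : ℝ) ∂μ := by simp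
      _ ≤ _ := setIntegral_mono (integrable_const _).integrableOn
        (hd.add ((hi _ t).const_mul K)).integrableOn fun ω => hu (ξ t ω)
  refine (Finset.sum_le_sum fun t _ => h1 t).trans ?_
  rw [Finset.sum_add_distrib, ← Finset.mul_sum]
  exact add_le_add ((le_abs_self _).trans (hB n T))
    (mul_le_mul_of_nonneg_left (hξ.sum_setIntegral_boundaryInd_le n T) hK)

theorem ae_frequently_hit (hM : M.Stable) (hξ : M.IsRealization μ ξ Y) :
    ∀ᵐ ω ∂μ, ∃ᶠ t in atTop, ∃ i, ξ t ω = Sum.inl i := by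
  have h : ∀ n, ∀ᵐ ω ∂μ, ∃ t, ω ∉ trajEvent ξ (beforeHit n t) := by
    intro n
    have h0 : μ.real (⋂ t, trajEvent ξ (beforeHit n t)) = 0 :=
      le_antisymm (ge_of_tendsto' (hξ.summable_beforeHit hM n).tendsto_atTop_zero fun t =>
        measureReal_mono (Set.iInter_subset _ t)) measureReal_nonneg
    rw [measureReal_eq_zero_iff] at h0
    filter_upwards [measure_eq_zero_iff_ae_notMem.1 h0] with ω hω
    simpa using hω
  filter_upwards [ae_all_iff.2 h] with ω hω
  rw [Nat.frequently_atTop_iff_infinite]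
  intro hfin
  -- With only finitely many hits, taking `n` to be their total number would keep the trajectory in
  -- `beforeHit n t` for all `t`.
  obtain ⟨t, ht⟩ := hω hfin.toFinset.card
  exact ht (Nat.count_le_card hfin (t + 1))

/-- Summing up to a hit of the boundary commutes with taking means if the mean absolute value of
the terms is bounded. -/
theorem integrable_and_hasSum_sum_range_hitTime (hM : M.Stable) (hξ : M.IsRealization μ ξ Y)
    {Z : ℕ → Ω → ℝ} (hZ : ∀ t, Integrable (Z t) μ) (n : ℕ) {C : ℝ}
    (hC : ∀ t, ∫ ω in trajEvent ξ (beforeHit n t), |Z t ω| ∂μ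
      ≤ C * μ.real (trajEvent ξ (beforeHit n t))) :
    Integrable (fun ω => ∑ t ∈ Finset.range (hitTime ξ n ω), Z t ω) μ ∧
      HasSum (fun t => ∫ ω in trajEvent ξ (beforeHit n t), Z t ω ∂μ)
        (∫ ω, ∑ t ∈ Finset.range (hitTime ξ n ω), Z t ω ∂μ) := by
  classical
  have hG := hξ.measurableSet_beforeHit n
  set F : ℕ → Ω → ℝ := fun t => (trajEvent ξ (beforeHit n t)).indicator (Z t) with hF
  have hFi : ∀ t, Integrable (F t) μ := fun t => (hZ t).indicator (hG t)
  have hFs : Summable fun t => ∫ ω, ‖F t ω‖ ∂μ := by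
    refine Summable.of_nonneg_of_le (fun t => integral_nonneg fun ω => norm_nonneg _)
      (fun t => ?_) ((hξ.summable_beforeHit hM n).mul_left C)
    simp only [hF, norm_indicator_eq_indicator_norm, Real.norm_eq_abs]
    rw [integral_indicator (hG t)]
    exact hC t
  have hsum : ∀ᵐ ω ∂μ,
      HasSum (fun t => F t ω) (∑ t ∈ Finset.range (hitTime ξ n ω), Z t ω) := by
    filter_upwards [hξ.ae_frequently_hit hM] with ω hω
    have e : ∑ t ∈ Finset.range (hitTime ξ n ω), Z t ω
        = ∑ t ∈ Finset.range (hitTime ξ n ω), F t ω :=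
      Finset.sum_congr rfl fun t ht =>
        (Set.indicator_of_mem ((lt_hitTime_iff hω n t).1 (Finset.mem_range.1 ht)) _).symm
    rw [e]
    exact hasSum_sum_of_ne_finset_zero fun t ht => Set.indicator_of_notMem
      (fun hmem => ht (Finset.mem_range.2 ((lt_hitTime_iff hω n t).2 hmem))) _
  refine ⟨integrable_of_hasSum hFi hFs hsum, ?_⟩
  have h := hasSum_integral_of_summable_integral_norm hFi hFs
  rw [integral_congr_ae (hsum.mono fun ω hω => hω.tsum_eq)] at h
  simpa only [hF, integral_indicator (hG _)] using h

/-- The mean profit up to the hit number `n` exists and differs from `n` times the stationary mean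
profit per control period by a bounded quantity. -/
theorem exists_abs_integral_profit_sub_le (hM : M.Stable) (hξ : M.IsRealization μ ξ Y) :
    ∃ B : ℝ, ∀ n : ℕ, Integrable (profit ξ Y n) μ ∧
      |∫ ω, profit ξ Y n ω ∂μ - n * M.meanProfit| ≤ B := by
  obtain ⟨h, hh⟩ := hM.exists_poisson
  obtain ⟨B, hB⟩ := hξ.exists_abs_sum_potential_le h
  obtain ⟨C, hC⟩ := hξ.exists_setIntegral_abs_le
  refine ⟨B, fun n => ?_⟩
  have hi := fun (g : Fin 2 ⊕ S → ℝ) t =>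
    (integrable_comp_state (μ := μ) hξ.measurableSet_state g t)
  set I := M.meanProfit
  have hbd : ∀ x : Fin 2 ⊕ S, |I * boundaryInd x| ≤ |I| := by
    rintro (i | k) <;> simp [boundaryInd]
  -- Charging `I` at each hit before summing makes the stopped total equal to the profit minus `n *
  -- I` almost surely.
  obtain ⟨h1, h2⟩ := hξ.integrable_and_hasSum_sum_range_hitTime hM
    (Z := fun t ω => Y t ω - I * boundaryInd (ξ t ω))
    (fun t => (hξ.integrable t).sub ((hi _ t).const_mul I)) n (C := C + |I|) (fun t => by
      refine (setIntegral_mono (g := fun ω => |Y t ω| + |I|)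
        ((hξ.integrable t).sub ((hi _ t).const_mul I)).abs.integrableOn
        ((hξ.integrable t).abs.add (integrable_const _)).integrableOn
        fun ω => (abs_sub _ _).trans (add_le_add_right (hbd _) _)).trans ?_
      rw [integral_add (hξ.integrable t).abs.integrableOn (integrable_const _).integrableOn,
        setIntegral_const, smul_eq_mul, add_mul, mul_comm |I|]
      exact add_le_add_left (hC t _ (knownAt_beforeHit n t)) _)
  have hae : (fun ω => ∑ t ∈ Finset.range (hitTime ξ n ω), (Y t ω - I * boundaryInd (ξ t ω)))
      =ᵐ[μ] fun ω => profit ξ Y n ω - n * I := by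
    filter_upwards [hξ.ae_frequently_hit hM] with ω hω
    rw [Finset.sum_sub_distrib, ← Finset.mul_sum, sum_range_hitTime_boundaryInd hω, mul_comm I]
    rfl
  have h3 : Integrable (profit ξ Y n) μ := by
    refine ((h1.congr hae).add (integrable_const (n * I))).congr (Eventually.of_forall fun ω => ?_)
    simp
  refine ⟨h3, ?_⟩
  rw [integral_congr_ae hae, integral_sub h3 (integrable_const _), integral_const,
    probReal_univ, one_smul] at h2
  -- By the Poisson equation each partial sum is an expected stopped decrease of `h`, bounded by `B`
  -- uniformly in `n` and `T`.
  refine le_of_tendsto' (h2.tendsto_sum_nat.abs) fun T => ?_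
  refine (congrArg abs (Finset.sum_congr rfl fun t _ => ?_)).trans_le (hB n T)
  rw [integral_sub (hξ.integrable t).integrableOn ((hi _ t).const_mul I).integrableOn,
    hξ.setIntegral_step (knownAt_beforeHit n t),
    ← integral_sub (hi _ t).integrableOn ((hi _ t).const_mul I).integrableOn]
  exact integral_congr_ae (Eventually.of_forall fun ω => hh (ξ t ω))

end IsRealization

/-! ### Passage to the limit -/

theorem tendsto_div_of_abs_sub_le {V : ℕ → ℝ} {I B : ℝ} (h : ∀ n : ℕ, |V n - n * I| ≤ B) :
    Tendsto (fun n : ℕ => V n / n) atTop (𝓝 I) := by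
  rw [tendsto_iff_norm_sub_tendsto_zero]
  refine squeeze_zero' (Eventually.of_forall fun _ => norm_nonneg _) ?_
    (tendsto_const_div_atTop_nhds_zero_nat B)
  filter_upwards [eventually_gt_atTop 0] with n hn
  have hn' : (0 : ℝ) < n := Nat.cast_pos.2 hn
  rw [Real.norm_eq_abs, div_sub' hn'.ne', abs_div, abs_of_pos hn']
  exact div_le_div_of_nonneg_right (h n) hn'.le

end TuningModel

theorem theorem3 {S : Type*} [Fintype S] [DecidableEq S] (M : TuningModel S) (hM : M.Stable)
    {Ω : Type*} [MeasurableSpace Ω] (μ : Measure Ω) [IsProbabilityMeasure μ]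
    (ξ : ℕ → Ω → Fin 2 ⊕ S) (Y : ℕ → Ω → ℝ) (hξ : M.IsRealization μ ξ Y) :
    -- the explicit formulas for the absorption probabilities and for the mean incomes
    IsUnit (1 - M.P00) ∧
    (∀ k i, M.absorbProb k i = ((1 - M.P00)⁻¹ * M.P01) k i) ∧
    (∀ k, M.meanIncome k = ∑ l, (1 - M.P00)⁻¹ k l * M.c l) ∧
    -- the boundary is hit infinitely often, and the mean accumulated profits exist
    (∀ᵐ ω ∂μ, ∃ᶠ t in atTop, ∃ i, ξ t ω = Sum.inl i) ∧
    (∀ n, Integrable (TuningModel.profit ξ Y n) μ) ∧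
    -- the stationary mean specific profit
    0 < ∑ l, M.α 1 l * M.absorbProb l 0 + ∑ l, M.α 0 l * (1 - M.absorbProb l 0) ∧
    Tendsto (fun n : ℕ => (∫ ω, TuningModel.profit ξ Y n ω ∂μ) / n) atTop
      (𝓝 (((∑ k, M.α 0 k * (M.d 0 k + M.meanIncome k)) * (∑ l, M.α 1 l * M.absorbProb l 0)
          + (∑ k, M.α 1 k * (M.d 1 k + M.meanIncome k))
            * (∑ l, M.α 0 l * (1 - M.absorbProb l 0)))
        / (∑ l, M.α 1 l * M.absorbProb l 0 + ∑ l, M.α 0 l * (1 - M.absorbProb l 0)))) := by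
  obtain ⟨B, hB⟩ := hξ.exists_abs_integral_profit_sub_le hM
  refine ⟨hM.isUnit_one_sub, hM.absorbProb_eq, hM.meanIncome_eq, hξ.ae_frequently_hit hM,
    fun n => (hB n).1, add_pos (hM.sum_mul_absorbProb_pos 1 0) ?_,
    TuningModel.tendsto_div_of_abs_sub_le fun n => (hB n).2⟩
  have h : ∀ l, 1 - M.absorbProb l 0 = M.absorbProb l 1 := fun l => by
    linarith [(hM l).2.2]
  simpa only [h] using hM.sum_mul_absorbProb_pos 0 1
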